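/- For $r>3$ put $$b=ri,\qquad s=\sqrt{4+b^2},\qquad u=-\Big(\frac1{2b}\Big)^{1/5}\big(8+2b+b^2+4s+bs\big)^{1/5},$$ $$a=\frac{u^2(-2-b+s)}{2b},\qquad c=\tfrac12\big(2+b^2+s-b-bs\big),$$ where the square root is the principal one (so $s=i\sqrt{r^2-4}$) and the fifth roots in $u$ may be chosen arbitrarily, for instance as principal values. Let $$A=\begin{pmatrix}u&a\\1&0\end{pmatrix},\qquad B=\begin{pmatrix}1&0\\0&b\end{pmatrix},\qquad C=\begin{pmatrix}c&0\\0&1\end{pmatrix}.$$ (1) For every $r>3$ and every choice of the fifth roots, $ABA^3BA=C$. (2) There is a set $F\subseteq(3,\infty)$ with $(3,\infty)\setminus F$ countable such that for every $r\in F$ and every choice of the fifth roots, the multiplicative semigroup generated by $A$ and $B$ is dense in the space of all $2\times2$ complex matrices. (3) Consequently there are uncountably many dense subsemigroups of the multiplicative semigroup of $2\times 2$ complex matrices that are generated by two distinct elements. -/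

import Mathlib

/-! Complex powers `z ^ (1 / 2 : ℂ)` and `z ^ (1 / 5 : ℂ)` are principal values. -/

noncomputable section

namespace DenseTwoGen

/-- `b = r i`. -/
def b (r : ℝ) : ℂ := (r : ℂ) * Complex.I

/-- The principal square root of `4 + b²`; for `r > 2` this is `i √(r² - 4)`. -/
def s (r : ℝ) : ℂ := (4 + b r ^ 2) ^ (1 / 2 : ℂ)

/-- The parameter `u`. The fifth root of unity `ζ` records the choice of the fifth roots:
`ζ = 1` is the choice of principal values, and as `ζ` runs over all the fifth roots of unity
one obtains all possible choices. -/
def u (ζ : ℂ) (r : ℝ) : ℂ :=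
  -(ζ * (1 / (2 * b r)) ^ (1 / 5 : ℂ) *
    (8 + 2 * b r + b r ^ 2 + 4 * s r + b r * s r) ^ (1 / 5 : ℂ))

/-- The parameter `a`. -/
def a (ζ : ℂ) (r : ℝ) : ℂ := u ζ r ^ 2 * (-2 - b r + s r) / (2 * b r)

/-- The parameter `c`. -/
def c (r : ℝ) : ℂ := 1 / 2 * (2 + b r ^ 2 + s r - b r - b r * s r)

/-- `A = [u, a; 1, 0]`. -/
def A (ζ : ℂ) (r : ℝ) : Matrix (Fin 2) (Fin 2) ℂ := !![u ζ r, a ζ r; 1, 0]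

/-- `B = [1, 0; 0, b]`. -/
def B (r : ℝ) : Matrix (Fin 2) (Fin 2) ℂ := !![1, 0; 0, b r]

/-- `C = [c, 0; 0, 1]`. -/
def C (r : ℝ) : Matrix (Fin 2) (Fin 2) ℂ := !![c r, 0; 0, 1]

/-- The subsemigroup of the multiplicative semigroup of complex `2 × 2` matrices
generated by `X` and `Y`: all nonempty finite products of copies of `X` and `Y`. -/
def gen (X Y : Matrix (Fin 2) (Fin 2) ℂ) : Subsemigroup (Matrix (Fin 2) (Fin 2) ℂ) :=
  Subsemigroup.closure {X, Y}

end DenseTwoGen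

end

/-! Write r = x + 1/x with x > 2 and y = ix. Then b = y - 1/y, s = y + 1/y, c = (y + 1)/y², a =
-u²/(y + 1) and u⁵ = -(y + 1)²/(y - 1). The word identity becomes rational algebra in which the
choice of roots matters only through u⁵ (`word_eq`).

For density, the closure of the semigroup contains A, diag(1, b) and, by the word identity, diag(c,
1). If the numbers b^k c^l are dense in ℂ and 0 < |c| < 1, limits of products of A with diagonal
matrices give two families of triangular matrices. Products within each family give essentially all
triangular matrices, and LU factorization gives everything (`mem_of_dense_pow_mul_pow`).

Since b⁴ > 0, density of the b^k c^l follows from Kronecker's theorem on the 2-torus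
(`dense_exp_pow_mul_exp_pow`), provided log |b⁴|, log |c| and arg c satisfy no integral relation.
Each candidate relation is analytic in x and not identically zero, so only countably many x fail
(`countable_relation`).

Uncountability follows because each two-generator semigroup is countable, so it contains B for only
countably many r. -/

open MeasureTheory Filter Topology in
/-- Averages of a nontrivial character along the orbit of a generic point tend to `0`. -/
theorem tendsto_average_pow_of_norm_one {χ : ℂ} (hχ : ‖χ‖ = 1) (h1 : χ ≠ 1) :
    Tendsto (fun N : ℕ => (N : ℂ)⁻¹ * ∑ k ∈ Finset.range N, χ ^ k) atTop (𝓝 0) := by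
  have hb : ∀ N : ℕ, ‖(N : ℂ)⁻¹ * ∑ k ∈ Finset.range N, χ ^ k‖ ≤ (N : ℝ)⁻¹ * (2 / ‖χ - 1‖) := by
    intro N
    rw [geom_sum_eq h1, norm_mul, norm_inv, Complex.norm_natCast, norm_div]
    gcongr
    calc ‖χ ^ N - 1‖ ≤ ‖χ ^ N‖ + ‖(1 : ℂ)‖ := norm_sub_le _ _
      _ = 2 := by rw [norm_pow, hχ]; norm_num
  refine squeeze_zero_norm hb ?_
  simpa using (tendsto_inv_atTop_nhds_zero_nat (𝕜 := ℝ)).mul_const (2 / ‖χ - 1‖)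

/-! ### Weyl averages and Kronecker's theorem on the torus. -/

namespace UnitAddTorus

open MeasureTheory Filter Topology

instance isProbabilityMeasure_unitAddCircle :
    IsProbabilityMeasure (volume : Measure UnitAddCircle) :=
  ⟨UnitAddCircle.measure_univ⟩

variable {d : Type*} [Fintype d]

theorem mFourier_apply_add (n : d → ℤ) (x y : UnitAddTorus d) :
    mFourier n (x + y) = mFourier n x * mFourier n y := by
  simp [mFourier, fourier_apply, smul_add, AddCircle.toCircle_add, Finset.prod_mul_distrib]

theorem mFourier_apply_nsmul (n : d → ℤ) (k : ℕ) (x : UnitAddTorus d) :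
    mFourier n (k • x) = mFourier n x ^ k := by
  induction k with
  | zero => simp [mFourier]
  | succ k ih => rw [succ_nsmul, mFourier_apply_add, ih, pow_succ]

theorem norm_mFourier_apply (n : d → ℤ) (x : UnitAddTorus d) : ‖mFourier n x‖ = 1 := by
  simp only [mFourier, ContinuousMap.coe_mk, norm_prod, fourier_apply, Circle.norm_coe,
    Finset.prod_const_one]

/-- Translating by g multiplies the integral by the value of the character at g, yet leaves it
unchanged. -/
theorem integral_mFourier_eq_zero {n : d → ℤ} {g : UnitAddTorus d} (h : mFourier n g ≠ 1) :
    ∫ x, mFourier n x = 0 := by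
  have h1 : ∫ x, mFourier n (x + g) = ∫ x, mFourier n x :=
    integral_add_right_eq_self (fun x => mFourier n x) g
  simp_rw [mFourier_apply_add] at h1
  rw [integral_mul_const] at h1
  by_contra h0
  exact h (mul_left_cancel₀ h0 (by rw [h1, mul_one]))

/-- Weyl equidistribution for trigonometric polynomials. -/
theorem tendsto_average_of_mem_span {g : UnitAddTorus d}
    (hg : ∀ n : d → ℤ, n ≠ 0 → mFourier n g ≠ 1) {p : C(UnitAddTorus d, ℂ)}
    (hp : p ∈ Submodule.span ℂ (Set.range (mFourier (d := d)))) :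
    Tendsto (fun N : ℕ => (N : ℂ)⁻¹ * ∑ k ∈ Finset.range N, p (k • g)) atTop (𝓝 (∫ x, p x)) := by
  have hint : ∀ q : C(UnitAddTorus d, ℂ), Integrable (fun x => q x) := fun q =>
    q.continuous.integrable_of_hasCompactSupport (HasCompactSupport.of_compactSpace _)
  induction hp using Submodule.span_induction with
  | mem q hq =>
    obtain ⟨n, rfl⟩ := hq
    by_cases hn : n = 0
    · subst hn
      simp only [mFourier_zero, ContinuousMap.one_apply, integral_const, probReal_univ,
        one_smul, Finset.sum_const, Finset.card_range, nsmul_eq_mul, mul_one]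
      refine tendsto_const_nhds.congr' ?_
      filter_upwards [eventually_ne_atTop 0] with N hN
      rw [inv_mul_cancel₀ (Nat.cast_ne_zero.2 hN)]
    · rw [integral_mFourier_eq_zero (hg n hn)]
      simp_rw [mFourier_apply_nsmul]
      exact tendsto_average_pow_of_norm_one (norm_mFourier_apply n g) (hg n hn)
  | zero => simp
  | add q q' _ _ h h' =>
    simp only [ContinuousMap.add_apply, Finset.sum_add_distrib, mul_add]
    rw [integral_add (hint q) (hint q')]
    exact h.add h'
  | smul c q _ h =>
    simp only [ContinuousMap.smul_apply, smul_eq_mul, ← Finset.mul_sum]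
    rw [integral_const_mul]
    simp_rw [mul_left_comm _ c]
    exact h.const_mul c

/-- Kronecker's theorem: if no nontrivial character is trivial at `g`, then the forward orbit
of `g` is dense in the torus. -/
theorem denseRange_nsmul {g : UnitAddTorus d} (hg : ∀ n : d → ℤ, n ≠ 0 → mFourier n g ≠ 1) :
    DenseRange (fun k : ℕ => k • g) := by
  rw [DenseRange, dense_iff_inter_open]
  rintro U hU ⟨x₀, hx₀⟩
  by_contra hne
  have hout : ∀ k : ℕ, k • g ∈ Uᶜ := fun k hk => hne ⟨k • g, hk, k, rfl⟩
  -- A bump function supported in U vanishes on the orbit but has integral δ > 0. A trigonometric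
  -- polynomial within δ/3 of it has orbit averages of size at most δ/3, which forces δ ≤ 2δ/3.
  obtain ⟨f, hf0, hf1, hf⟩ := exists_continuous_zero_one_of_isClosed hU.isClosed_compl
    (isClosed_singleton (x := x₀)) (by simpa using hx₀)
  have hpos : 0 < ∫ x, f x := by
    refine f.continuous.integral_pos_of_hasCompactSupport_nonneg_nonzero
      (HasCompactSupport.of_compactSpace _) (fun x => (hf x).1) (x := x₀) ?_
    rw [hf1 rfl]; exact one_ne_zero
  set δ := ∫ x, f x with hδ
  let F : C(UnitAddTorus d, ℂ) := ⟨fun x => (f x : ℂ), by fun_prop⟩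
  have hFint : ∫ x, F x = (δ : ℂ) := integral_ofReal
  have hmem : F ∈ closure (Submodule.span ℂ (Set.range (mFourier (d := d))) :
      Set C(UnitAddTorus d, ℂ)) := by
    rw [← Submodule.topologicalClosure_coe, span_mFourier_closure_eq_top]; trivial
  obtain ⟨p, hp, hdist⟩ := Metric.mem_closure_iff.1 hmem (δ / 3) (by positivity)
  have hsub : ∀ x, ‖F x - p x‖ ≤ δ / 3 := fun x => by
    rw [← dist_eq_norm]; exact (ContinuousMap.dist_apply_le_dist x).trans hdist.le
  have hint : ∀ q : C(UnitAddTorus d, ℂ), Integrable (fun x => q x) := fun q =>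
    q.continuous.integrable_of_hasCompactSupport (HasCompactSupport.of_compactSpace _)
  have h1 : ‖(δ : ℂ) - ∫ x, p x‖ ≤ δ / 3 := by
    rw [← hFint, ← integral_sub (hint F) (hint p)]
    simpa only [probReal_univ, mul_one] using
      norm_integral_le_of_norm_le_const (μ := volume) (ae_of_all _ hsub)
  have h2 : ‖∫ x, p x‖ ≤ δ / 3 := by
    refine le_of_tendsto (tendsto_average_of_mem_span hg hp).norm (Eventually.of_forall fun N => ?_)
    have hk : ∀ k ∈ Finset.range N, ‖p (k • g)‖ ≤ δ / 3 := fun k _ => by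
      have h := hsub (k • g)
      have h0 : F (k • g) = 0 := by simp [F, hf0 (hout k)]
      rwa [h0, zero_sub, norm_neg] at h
    rw [norm_mul, norm_inv, Complex.norm_natCast]
    rcases Nat.eq_zero_or_pos N with rfl | hN
    · simp; positivity
    · have hN' : (0 : ℝ) < N := Nat.cast_pos.2 hN
      rw [inv_mul_le_iff₀ hN']
      simpa using norm_sum_le_of_le _ hk
  have h3 : δ ≤ ‖(δ : ℂ) - ∫ x, p x‖ + ‖∫ x, p x‖ := by
    have h := norm_add_le ((δ : ℂ) - ∫ x, p x) (∫ x, p x)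
    rwa [sub_add_cancel, Complex.norm_real, Real.norm_of_nonneg hpos.le] at h
  linarith

end UnitAddTorus

/-! ### From the torus to the multiplicative group of ℂ. -/

section

open Filter Topology

/-- Kronecker's theorem in multiplicative form: the semigroup generated by `exp β` and
`exp (-α + θ i)` is dense in the complex plane. -/
theorem dense_exp_pow_mul_exp_pow {α β θ : ℝ} (hα : 0 < α) (hβ : 0 < β)
    (h : ∀ p q n : ℤ, p * α + (q * (θ / (2 * Real.pi)) - n) * β = 0 → p = 0 ∧ q = 0) :
    Dense {z : ℂ | ∃ k l : ℕ,
      z = Complex.exp β ^ k * Complex.exp (-α + θ * Complex.I) ^ l} := by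
  have hpi := Real.pi_pos
  set g : UnitAddTorus (Fin 2) := ![((-(α / β) : ℝ) : UnitAddCircle),
    ((θ / (2 * Real.pi) : ℝ) : UnitAddCircle)] with hgdef
  have hg : ∀ n : Fin 2 → ℤ, n ≠ 0 → UnitAddTorus.mFourier n g ≠ 1 := by
    intro n hn h1
    simp only [UnitAddTorus.mFourier, ContinuousMap.coe_mk, Fin.prod_univ_two, hgdef,
      Matrix.cons_val_zero, Matrix.cons_val_one, fourier_coe_apply] at h1
    rw [← Complex.exp_add, Complex.exp_eq_one_iff] at h1
    obtain ⟨m, hm⟩ := h1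
    have h2 : ((n 0 * (-(α / β)) + n 1 * (θ / (2 * Real.pi)) : ℝ) : ℂ) = ((m : ℝ) : ℂ) := by
      refine mul_left_cancel₀ Complex.two_pi_I_ne_zero ?_
      push_cast at hm ⊢
      simp only [div_one] at hm
      linear_combination hm
    have h3 := Complex.ofReal_injective h2
    obtain ⟨h4, h5⟩ := h (-n 0) (n 1) m (by rw [← h3]; push_cast; field_simp; ring)
    exact hn (by ext i; fin_cases i <;> simp_all)
  have hdense := UnitAddTorus.denseRange_nsmul hg
  have hne : Dense ({0}ᶜ : Set ℂ) := dense_compl_singleton 0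
  refine dense_iff_inter_open.2 fun U hU hUne => ?_
  obtain ⟨w, hwU, hw⟩ := hne.inter_open_nonempty U hU hUne
  have hw0 : w ≠ 0 := hw
  let Φ : ℝ × ℝ → ℂ := fun v => Complex.exp (v.1 * β + v.2 * (2 * Real.pi) * Complex.I)
  have hΦ : Continuous Φ := by fun_prop
  set v₀ : ℝ × ℝ := ((Complex.log w).re / β, (Complex.log w).im / (2 * Real.pi)) with hv₀
  have hv : Φ v₀ = w := by
    have : ((v₀.1 : ℂ) * β + v₀.2 * (2 * Real.pi) * Complex.I) = Complex.log w := by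
      simp only [hv₀]; push_cast
      rw [div_mul_cancel₀ _ (Complex.ofReal_ne_zero.2 hβ.ne'),
        div_mul_cancel₀ _ (mul_ne_zero two_ne_zero (Complex.ofReal_ne_zero.2 hpi.ne')),
        Complex.re_add_im]
    simp only [Φ, this, Complex.exp_log hw0]
  obtain ⟨ε, hε, hball⟩ := Metric.isOpen_iff.1 (hU.preimage hΦ) v₀ (by simpa [hv] using hwU)
  let V : ℝ → Set UnitAddCircle := fun x => ((↑) : ℝ → UnitAddCircle) '' Metric.ball x ε
  have hV : ∀ x, IsOpen (V x) := fun x => QuotientAddGroup.isOpenMap_coe _ Metric.isOpen_ball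
  -- The torus only determines the exponent k of exp β as some integer. Delaying the orbit by L
  -- steps makes k = x + mα/β positive.
  obtain ⟨L, hL⟩ := exists_nat_gt ((ε - v₀.1) * β / α)
  have hW : IsOpen {z : UnitAddTorus (Fin 2) |
      (z + L • g) 0 ∈ V v₀.1 ∧ (z + L • g) 1 ∈ V v₀.2} :=
    ((hV _).preimage (by fun_prop)).inter ((hV _).preimage (by fun_prop))
  have hWne : {z : UnitAddTorus (Fin 2) |
      (z + L • g) 0 ∈ V v₀.1 ∧ (z + L • g) 1 ∈ V v₀.2}.Nonempty :=
    ⟨![(v₀.1 : UnitAddCircle), (v₀.2 : UnitAddCircle)] - L • g, by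
      simp only [Set.mem_ofPred_eq, sub_add_cancel]
      exact ⟨⟨_, Metric.mem_ball_self hε, rfl⟩, ⟨_, Metric.mem_ball_self hε, rfl⟩⟩⟩
  obtain ⟨_, ⟨h0, h1⟩, l, rfl⟩ := hdense.inter_open_nonempty _ hW hWne
  simp only [← add_nsmul] at h0 h1
  obtain ⟨x, hx, hx'⟩ := h0
  obtain ⟨y, hy, hy'⟩ := h1
  set m := l + L with hm
  have hx2 : ((x : ℝ) : UnitAddCircle) = ((m * (-(α / β)) : ℝ) : UnitAddCircle) := by
    rw [hx', ← nsmul_eq_mul, AddCircle.coe_nsmul]; simp [hgdef]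
  have hy2 : ((y : ℝ) : UnitAddCircle) = ((m * (θ / (2 * Real.pi)) : ℝ) : UnitAddCircle) := by
    rw [hy', ← nsmul_eq_mul, AddCircle.coe_nsmul]; simp [hgdef]
  obtain ⟨k, hk⟩ := AddCircle.coe_eq_zero_iff (1 : ℝ) |>.1
    (by rw [AddCircle.coe_sub, hx2, sub_self] :
      ((x - m * (-(α / β)) : ℝ) : AddCircle (1 : ℝ)) = 0)
  obtain ⟨j, hj⟩ := AddCircle.coe_eq_zero_iff (1 : ℝ) |>.1
    (by rw [AddCircle.coe_sub, hy2, sub_self] :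
      ((y - m * (θ / (2 * Real.pi)) : ℝ) : AddCircle (1 : ℝ)) = 0)
  simp only [zsmul_eq_mul, mul_one] at hk hj
  have hLm : (L : ℝ) ≤ m := by exact_mod_cast Nat.le_add_left L l
  have hk0 : (0 : ℝ) < k := by
    have h1 : v₀.1 - ε < x := by
      have := (abs_lt.1 (Real.dist_eq x _ ▸ Metric.mem_ball.1 hx)).1
      linarith
    have h2 : ε - v₀.1 < L * (α / β) := by
      rw [div_lt_iff₀ hα] at hL
      rw [← mul_div_assoc, lt_div_iff₀ hβ]; exact hL
    have h3 : L * (α / β) ≤ m * (α / β) := by gcongr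
    rw [hk]; linarith
  obtain ⟨k', rfl⟩ := Int.eq_ofNat_of_zero_le (by exact_mod_cast hk0.le : 0 ≤ k)
  have hxy : (x, y) ∈ Metric.ball v₀ ε := by
    rw [Metric.mem_ball, Prod.dist_eq, max_lt_iff]; exact ⟨hx, hy⟩
  refine ⟨Φ (x, y), hball hxy, k', m, ?_⟩
  have hxβ : x * β = k' * β - m * α := by
    have : x = k' - m * (α / β) := by simp only [Int.cast_natCast] at hk; linarith
    rw [this]; field_simp
  have hyπ : y * (2 * Real.pi) = m * θ + j * (2 * Real.pi) := by
    have : y = m * (θ / (2 * Real.pi)) + j := by linarith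
    rw [this]; field_simp
  rw [← Complex.exp_nat_mul, ← Complex.exp_nat_mul, ← Complex.exp_add,
    Complex.exp_eq_exp_iff_exists_int]
  refine ⟨j, ?_⟩
  have e1 := congrArg Complex.ofReal hxβ
  have e2 := congrArg Complex.ofReal hyπ
  push_cast at e1 e2
  linear_combination e1 + Complex.I * e2

end

/-! ### Closed matrix semigroups. -/

section

open Filter Topology Matrix

theorem exists_seq_pow_mul_pow_tendsto {b c : ℂ} (hc : c ≠ 0)
    (hD : Dense {z : ℂ | ∃ k l : ℕ, z = b ^ k * c ^ l}) (w : ℂ) :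
    ∃ k l : ℕ → ℕ, (∀ j, j ≤ l j) ∧
      Tendsto (fun j => b ^ k j * c ^ (l j + 1)) atTop (𝓝 w) := by
  have hj : ∀ j : ℕ, ∃ k l : ℕ, j ≤ l ∧ dist (b ^ k * c ^ (l + 1)) w < 1 / ((j : ℝ) + 1) := by
    intro j
    have hcj : 0 < ‖c ^ (j + 1)‖ := norm_pos_iff.2 (pow_ne_zero _ hc)
    -- Approximating w / c^(j+1) instead of w forces the exponent of c to infinity.
    obtain ⟨_, ⟨k, l, rfl⟩, hz⟩ := hD.exists_dist_lt (w / c ^ (j + 1))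
      (by positivity : 0 < 1 / ((j : ℝ) + 1) / ‖c ^ (j + 1)‖)
    refine ⟨k, l + j, Nat.le_add_left j l, ?_⟩
    rw [dist_comm, dist_eq_norm, lt_div_iff₀ hcj, ← norm_mul, sub_mul,
      div_mul_cancel₀ _ (pow_ne_zero _ hc), mul_assoc, ← pow_add] at hz
    rwa [dist_eq_norm, add_assoc]
  choose k l hl hd using hj
  refine ⟨k, l, hl, tendsto_iff_dist_tendsto_zero.2 ?_⟩
  exact squeeze_zero (fun _ => dist_nonneg) (fun j => (hd j).le)
    tendsto_one_div_add_atTop_nhds_zero_nat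

theorem tendsto_matrix_fin_two {ι : Type*} {F : Filter ι} {f : ι → Matrix (Fin 2) (Fin 2) ℂ}
    {p q r s : ℂ} (h00 : Tendsto (fun j => f j 0 0) F (𝓝 p))
    (h01 : Tendsto (fun j => f j 0 1) F (𝓝 q)) (h10 : Tendsto (fun j => f j 1 0) F (𝓝 r))
    (h11 : Tendsto (fun j => f j 1 1) F (𝓝 s)) : Tendsto f F (𝓝 !![p, q; r, s]) := by
  refine tendsto_pi_nhds.2 fun i => tendsto_pi_nhds.2 fun j => ?_
  fin_cases i <;> fin_cases j <;> simpa

/-- A closed set containing `f t` for all `t ≠ t₀` contains `f t₀`. -/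
theorem mem_of_forall_ne_mem {X : Type*} [TopologicalSpace X] {S : Set X} (hS : IsClosed S)
    {f : ℂ → X} (hf : Continuous f) (t₀ : ℂ) (h : ∀ t, t ≠ t₀ → f t ∈ S) (t : ℂ) : f t ∈ S := by
  have : closure ({t₀}ᶜ : Set ℂ) ⊆ f ⁻¹' S :=
    closure_minimal (fun t ht => h t ht) (hS.preimage hf)
  exact this (dense_compl_singleton t₀ t)

namespace Subsemigroup

variable {S : Subsemigroup (Matrix (Fin 2) (Fin 2) ℂ)} {u a b c : ℂ}

/-- The exponent m + 1 is needed because S need not contain the identity. -/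
theorem diag_pow_mem (hB : !![1, 0; 0, b] ∈ S) (hC : !![c, 0; 0, 1] ∈ S) (m n : ℕ) :
    !![c ^ (m + 1), 0; 0, b ^ n] ∈ S := by
  induction n with
  | zero =>
    induction m with
    | zero => simpa using hC
    | succ m ih => simpa [pow_succ] using S.mul_mem ih hC
  | succ n ih => simpa [pow_succ] using S.mul_mem ih hB

theorem lower_mem (hS : IsClosed (S : Set (Matrix (Fin 2) (Fin 2) ℂ))) (hu : u ≠ 0) (ha : a ≠ 0)
    (hc : c ≠ 0) (hc1 : ‖c‖ < 1) (hD : Dense {z : ℂ | ∃ k l : ℕ, z = b ^ k * c ^ l})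
    (hA : !![u, a; 1, 0] ∈ S) (hB : !![1, 0; 0, b] ∈ S) (hC : !![c, 0; 0, 1] ∈ S) (z w : ℂ) :
    !![z, 0; w, a / u * w] ∈ S := by
  -- The exponents are paired crosswise: each diagonal factor takes its power of c from one sequence
  -- and its power of b from the other. Entries carrying c^(k+1) c^(m+1) then die, and the others
  -- converge.
  obtain ⟨n, k, hk, hz⟩ := exists_seq_pow_mul_pow_tendsto hc hD (z / a)
  obtain ⟨l, m, hm, hw⟩ := exists_seq_pow_mul_pow_tendsto hc hD (w / u)
  have h0 := tendsto_pow_atTop_nhds_zero_of_norm_lt_one hc1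
  have hkl : Tendsto (fun j => c ^ (k j + 1)) atTop (𝓝 0) :=
    h0.comp (tendsto_atTop_mono (fun j => (hk j).trans (Nat.le_succ _)) tendsto_id)
  have hml : Tendsto (fun j => c ^ (m j + 1)) atTop (𝓝 0) :=
    h0.comp (tendsto_atTop_mono (fun j => (hm j).trans (Nat.le_succ _)) tendsto_id)
  refine hS.mem_of_tendsto (f := fun j => !![c ^ (k j + 1), 0; 0, b ^ l j] * !![u, a; 1, 0] *
    !![c ^ (m j + 1), 0; 0, b ^ n j] * !![u, a; 1, 0]) (b := atTop)
    (tendsto_matrix_fin_two ?_ ?_ ?_ ?_) (Eventually.of_forall fun j => S.mul_mem (S.mul_mem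
      (S.mul_mem (diag_pow_mem hB hC _ _) hA) (diag_pow_mem hB hC _ _)) hA)
  · have h := ((hkl.mul hml).const_mul (u ^ 2)).add (hz.const_mul a)
    convert h using 2
    · simp; ring
    · field_simp; ring
  · have h := (hkl.mul hml).const_mul (u * a)
    convert h using 2
    · simp; ring
    · ring
  · convert hw.const_mul u using 2
    · simp; ring
    · field_simp
  · convert hw.const_mul a using 2
    · simp; ring
    · field_simp

theorem upper_mem (hS : IsClosed (S : Set (Matrix (Fin 2) (Fin 2) ℂ))) (ha : a ≠ 0)
    (hc : c ≠ 0) (hc1 : ‖c‖ < 1) (hD : Dense {z : ℂ | ∃ k l : ℕ, z = b ^ k * c ^ l})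
    (hA : !![u, a; 1, 0] ∈ S) (hB : !![1, 0; 0, b] ∈ S) (hC : !![c, 0; 0, 1] ∈ S) (z w : ℂ) :
    !![z, u * w; 0, w] ∈ S := by
  obtain ⟨n, k, hk, hz⟩ := exists_seq_pow_mul_pow_tendsto hc hD (z / a)
  obtain ⟨l, m, hm, hw⟩ := exists_seq_pow_mul_pow_tendsto hc hD (w / a)
  have h0 := tendsto_pow_atTop_nhds_zero_of_norm_lt_one hc1
  have hkl : Tendsto (fun j => c ^ (k j + 1)) atTop (𝓝 0) :=
    h0.comp (tendsto_atTop_mono (fun j => (hk j).trans (Nat.le_succ _)) tendsto_id)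
  have hml : Tendsto (fun j => c ^ (m j + 1)) atTop (𝓝 0) :=
    h0.comp (tendsto_atTop_mono (fun j => (hm j).trans (Nat.le_succ _)) tendsto_id)
  refine hS.mem_of_tendsto (f := fun j => !![u, a; 1, 0] * !![c ^ (m j + 1), 0; 0, b ^ n j] *
    !![u, a; 1, 0] * !![c ^ (k j + 1), 0; 0, b ^ l j]) (b := atTop)
    (tendsto_matrix_fin_two ?_ ?_ ?_ ?_) (Eventually.of_forall fun j => S.mul_mem (S.mul_mem
      (S.mul_mem hA (diag_pow_mem hB hC _ _)) hA) (diag_pow_mem hB hC _ _))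
  · have h := ((hkl.mul hml).const_mul (u ^ 2)).add (hz.const_mul a)
    convert h using 2
    · simp; ring
    · field_simp; ring
  · convert hw.const_mul (u * a) using 2
    · simp; ring
    · field_simp
  · convert (hkl.mul hml).const_mul u using 2
    · simp; ring
    · ring
  · convert hw.const_mul a using 2
    · simp; ring
    · field_simp

/-- Two members of the family multiply to any lower triangular matrix except when β = γ/κ;
closedness fills in that value. -/
theorem lowerTriangular_mem (hS : IsClosed (S : Set (Matrix (Fin 2) (Fin 2) ℂ))) {κ : ℂ}
    (hκ : κ ≠ 0) (h : ∀ z w : ℂ, !![z, 0; w, κ * w] ∈ S) (α β γ : ℂ) :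
    !![α, 0; β, γ] ∈ S := by
  refine mem_of_forall_ne_mem hS (f := fun β => !![α, 0; β, γ]) (by fun_prop) (γ / κ)
    (fun β hβ => ?_) β
  obtain ⟨δ, rfl⟩ : ∃ δ, β = δ + γ / κ := ⟨β - γ / κ, by ring⟩
  have hδ : δ ≠ 0 := by simpa using hβ
  change _ ∈ S
  convert S.mul_mem (h (α / δ) 1) (h δ (γ / κ ^ 2)) using 1
  ext i j
  fin_cases i <;> fin_cases j <;> simp <;> field_simp

theorem upperTriangular_mem (hS : IsClosed (S : Set (Matrix (Fin 2) (Fin 2) ℂ)))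
    (hu : u ≠ 0) (h : ∀ z w : ℂ, !![z, u * w; 0, w] ∈ S) {α : ℂ} (hα : α ≠ 0) (β γ : ℂ) :
    !![α, β; 0, γ] ∈ S := by
  refine mem_of_forall_ne_mem hS (f := fun β => !![α, β; 0, γ]) (by fun_prop) (u * γ)
    (fun β hβ => ?_) β
  obtain ⟨δ, rfl⟩ : ∃ δ, β = δ + u * γ := ⟨β - u * γ, by ring⟩
  have hδ : δ ≠ 0 := by simpa using hβ
  change _ ∈ S
  convert S.mul_mem (h α (γ * (u * α) / δ)) (h 1 (δ / (u * α))) using 1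
  ext i j
  fin_cases i <;> fin_cases j <;> simp <;> field_simp

/-- A closed semigroup containing `[u, a; 1, 0]`, `diag(1, b)` and `diag(c, 1)`, where the
products `b ^ k * c ^ l` are dense and `0 < ‖c‖ < 1`, contains every matrix. -/
theorem mem_of_dense_pow_mul_pow (hS : IsClosed (S : Set (Matrix (Fin 2) (Fin 2) ℂ)))
    (hu : u ≠ 0) (ha : a ≠ 0) (hc : c ≠ 0) (hc1 : ‖c‖ < 1)
    (hD : Dense {z : ℂ | ∃ k l : ℕ, z = b ^ k * c ^ l})
    (hA : !![u, a; 1, 0] ∈ S) (hB : !![1, 0; 0, b] ∈ S) (hC : !![c, 0; 0, 1] ∈ S)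
    (M : Matrix (Fin 2) (Fin 2) ℂ) : M ∈ S := by
  rw [Matrix.eta_fin_two M]
  refine mem_of_forall_ne_mem hS (f := fun p => !![p, M 0 1; M 1 0, M 1 1]) (by fun_prop) 0
    (fun p hp => ?_) (M 0 0)
  change _ ∈ S
  -- LU factorization, with pivot p ≠ 0.
  convert S.mul_mem
    (lowerTriangular_mem hS (div_ne_zero ha hu) (lower_mem hS hu ha hc hc1 hD hA hB hC)
      1 (M 1 0 / p) (M 1 1 - M 1 0 * M 0 1 / p))
    (upperTriangular_mem hS hu (upper_mem hS ha hc hc1 hD hA hB hC) hp (M 0 1) 1) using 1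
  ext i j
  fin_cases i <;> fin_cases j <;> simp <;> field_simp
  ring

end Subsemigroup

end

/-! ### Independence for all but countably many parameters. -/

section

open Real Set
open scoped ContDiff

/-- The zeros are isolated by the identity theorem, and a discrete subset of a hereditarily Lindelöf
space is countable. -/
theorem AnalyticOnNhd.countable_zeros {f : ℝ → ℝ} {U : Set ℝ} {x : ℝ} (hf : AnalyticOnNhd ℝ f U)
    (hx : x ∈ U) (hfx : f x ≠ 0) (hU : IsConnected U) : {y | y ∈ U ∧ f y = 0}.Countable := by
  have h : IsDiscrete ((f ⁻¹' {0}ᶜ)ᶜ ∩ U) := isDiscrete_of_codiscreteWithin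
    (by rw [compl_compl]; exact hf.preimage_zero_mem_codiscreteWithin hfx hx hU)
  refine ((HereditarilyLindelofSpace.isLindelof _).countable_of_isDiscrete h).mono ?_
  rintro y ⟨hy, h0⟩
  exact ⟨fun hne => hne h0, hy⟩

theorem intCast_mul_log_two_add_mul_log_three {m n : ℤ} (h : m * log 2 + n * log 3 = 0) :
    m = 0 ∧ n = 0 := by
  have h2 : 0 < log 2 := log_pos (by norm_num)
  have h3 : 0 < log 3 := log_pos (by norm_num)
  have habs : (m.natAbs : ℝ) * log 2 = n.natAbs * log 3 := by
    have h1 : |(m : ℝ)| * log 2 = |(n : ℝ)| * log 3 := by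
      have h' := congrArg abs (eq_neg_of_add_eq_zero_left h)
      rwa [abs_neg, abs_mul, abs_mul, abs_of_pos h2, abs_of_pos h3] at h'
    simpa only [Nat.cast_natAbs, Int.cast_abs] using h1
  have hpow : 2 ^ m.natAbs = 3 ^ n.natAbs := by
    rw [← log_pow, ← log_pow] at habs
    have := log_injOn_pos (by simp : (2 : ℝ) ^ m.natAbs ∈ Ioi 0)
      (by simp : (3 : ℝ) ^ n.natAbs ∈ Ioi 0) habs
    exact_mod_cast this
  have hcop : Nat.Coprime (2 ^ m.natAbs) (3 ^ n.natAbs) := Nat.Coprime.pow _ _ (by norm_num)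
  have h1 : 3 ^ n.natAbs = 1 := by rwa [hpow, Nat.coprime_self] at hcop
  rw [h1] at hpow
  constructor
  · simpa using hpow
  · simpa using h1

namespace DenseTwoGen

/-- `-log |c|` at `r = x + 1 / x`. -/
noncomputable def decayRate (x : ℝ) : ℝ := 2 * log x - 1 / 2 * log (1 + x ^ 2)

/-- `log |b ^ 4|` at `r = x + 1 / x`. -/
noncomputable def growthRate (x : ℝ) : ℝ := 4 * log (x + 1 / x)

/-- An integral linear relation between `decayRate x / growthRate x`, the argument of `c` over
`2 * π`, and `1`. -/
noncomputable def relation (p q n : ℤ) (x : ℝ) : ℝ :=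
  p * decayRate x + (q * ((π + arctan x) / (2 * π)) - n) * growthRate x

theorem analyticOnNhd_relation (p q n : ℤ) : AnalyticOnNhd ℝ (relation p q n) (Ioi 0) := by
  intro x hx
  have hx0 : x ≠ 0 := ne_of_gt hx
  have hx1 : x + 1 / x ≠ 0 := by have : 0 < x := hx; positivity
  have hx2 : 1 + x ^ 2 ≠ 0 := by positivity
  refine ContDiffAt.analyticAt ?_
  have hinv : ContDiffAt ℝ ω (fun y : ℝ => y + 1 / y) x :=
    contDiffAt_id.add (contDiffAt_const.div contDiffAt_id hx0)
  have hlog : ContDiffAt ℝ ω log x := contDiffAt_log.2 hx0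
  have hsq : ContDiffAt ℝ ω (fun y : ℝ => log (1 + y ^ 2)) x :=
    (contDiffAt_const.add (contDiffAt_id.pow 2)).log hx2
  have harc : ContDiffAt ℝ ω arctan x := contDiff_arctan.contDiffAt
  unfold relation decayRate growthRate
  exact (contDiffAt_const.mul ((contDiffAt_const.mul hlog).sub (contDiffAt_const.mul hsq))).add
    (((contDiffAt_const.mul ((contDiffAt_const.add harc).div_const _)).sub contDiffAt_const).mul
      (contDiffAt_const.mul (hinv.log hx1)))

/-- At 1 and √3 the arctangent is a rational multiple of π and all logarithms lie in the span of log
2 and log 3. The point 1 gives one linear equation and √3 gives two, which together force p = q = 0.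
-/
theorem eq_zero_of_relation_eq_zero {p q n : ℤ} (h1 : relation p q n 1 = 0)
    (h3 : relation p q n (√3) = 0) : p = 0 ∧ q = 0 := by
  have hpi : π ≠ 0 := pi_ne_zero
  have e1 : p - 5 * q + 8 * n = 0 := by
    have hl : log 2 ≠ 0 := (log_pos (by norm_num)).ne'
    have h : ((p - 5 * q + 8 * n : ℤ) : ℝ) * log 2 = 0 := by
      simp only [relation, decayRate, growthRate, arctan_one, log_one] at h1
      norm_num at h1
      push_cast
      field_simp at h1
      linear_combination -h1
    exact_mod_cast (mul_eq_zero.1 h).resolve_right hl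
  have hs : √3 ^ 2 = 3 := sq_sqrt (by norm_num)
  have hlog : log (√3) = log 3 / 2 := log_sqrt (by norm_num)
  have hlog4 : log 4 = 2 * log 2 := by
    rw [show (4 : ℝ) = 2 ^ 2 by norm_num, log_pow]; norm_num
  have hg : log (√3 + 1 / √3) = 2 * log 2 - log 3 / 2 := by
    have : √3 + 1 / √3 = 4 / √3 := by field_simp; rw [hs]; norm_num
    rw [this, log_div (by norm_num) (by positivity), hlog, hlog4]
  have e2 : ((-3 * p + 16 * q - 24 * n : ℤ) : ℝ) * log 2
      + ((3 * p - 4 * q + 6 * n : ℤ) : ℝ) * log 3 = 0 := by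
    simp only [relation, decayRate, growthRate, arctan_sqrt_three, hs, hlog, hg] at h3
    rw [show (1 : ℝ) + 3 = 4 by norm_num, hlog4] at h3
    push_cast
    field_simp at h3
    linear_combination (1 / 4) * h3
  obtain ⟨e3, e4⟩ := intCast_mul_log_two_add_mul_log_three e2
  omega

theorem countable_relation : {x : ℝ | 0 < x ∧
    ¬ ∀ p q n : ℤ, relation p q n x = 0 → p = 0 ∧ q = 0}.Countable := by
  have h : ∀ t : ℤ × ℤ × ℤ, ¬ (t.1 = 0 ∧ t.2.1 = 0) →
      {x : ℝ | x ∈ Ioi 0 ∧ relation t.1 t.2.1 t.2.2 x = 0}.Countable := by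
    intro t ht
    have hne : ∃ x ∈ Ioi (0 : ℝ), relation t.1 t.2.1 t.2.2 x ≠ 0 := by
      by_contra! hall
      exact ht (eq_zero_of_relation_eq_zero (hall 1 (by simp)) (hall (√3) (by simp)))
    obtain ⟨x, hx, hfx⟩ := hne
    exact (analyticOnNhd_relation _ _ _).countable_zeros hx hfx isConnected_Ioi
  refine (Set.countable_iUnion fun t : {t : ℤ × ℤ × ℤ // ¬ (t.1 = 0 ∧ t.2.1 = 0)} =>
    h t.1 t.2).mono ?_
  rintro x ⟨hx, hr⟩
  push Not at hr
  obtain ⟨p, q, n, h0, hpq⟩ := hr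
  exact Set.mem_iUnion.2 ⟨⟨(p, q, n), fun hh => hpq hh.1 hh.2⟩, hx, h0⟩

end DenseTwoGen

end

/-! ### Rational parametrization and the word identity. -/

section

open Complex

namespace DenseTwoGen

/-- The witness is the larger root of x² - rx + 1 = 0. The bound x > 2 later ensures 1 + x² < x⁴,
that is |c| < 1. -/
theorem exists_add_one_div_eq {r : ℝ} (hr : 3 < r) : ∃ x : ℝ, 2 < x ∧ r = x + 1 / x := by
  have h4 : (0 : ℝ) ≤ r ^ 2 - 4 := by nlinarith
  have hs : 1 < √(r ^ 2 - 4) := Real.lt_sqrt_of_sq_lt (by nlinarith)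
  have hsq : √(r ^ 2 - 4) ^ 2 = r ^ 2 - 4 := Real.sq_sqrt h4
  refine ⟨(r + √(r ^ 2 - 4)) / 2, by linarith, ?_⟩
  have h0 : r + √(r ^ 2 - 4) ≠ 0 := by positivity
  field_simp
  linear_combination -hsq

section Parametrization

variable {x : ℝ}

theorem b_eq (hx : 1 < x) : b (x + 1 / x) * (I * x) = (I * x) ^ 2 - 1 := by
  have hx0 : (x : ℂ) ≠ 0 := ofReal_ne_zero.2 (by linarith)
  simp only [b]; push_cast
  field_simp
  linear_combination (1 : ℂ) * I_sq

theorem s_eq (hx : 1 < x) : s (x + 1 / x) * (I * x) = (I * x) ^ 2 + 1 := by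
  have hx0 : (x : ℂ) ≠ 0 := ofReal_ne_zero.2 (by linarith)
  have ht : 0 < x - 1 / x := by
    rw [sub_pos, div_lt_iff₀ (by linarith)]; nlinarith
  -- The argument π/2 is the included endpoint of (-π/2, π/2], where the principal root undoes
  -- squaring.
  have harg : arg ((x - 1 / x : ℝ) * I) = Real.pi / 2 := by
    rw [arg_real_mul I ht, arg_I]
  have h : s (x + 1 / x) = (x - 1 / x : ℝ) * I := by
    have hsq : 4 + b (x + 1 / x) ^ 2 = ((x - 1 / x : ℝ) * I) ^ 2 := by
      simp only [b, mul_pow, I_sq]; push_cast; field_simp; ring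
    rw [s, hsq, one_div (2 : ℂ)]
    exact pow_cpow_ofNat_inv (n := 2) (harg.symm ▸ neg_lt_self Real.pi_div_two_pos)
      harg.le
  rw [h]; push_cast
  field_simp
  linear_combination (-1 : ℂ) * I_sq

theorem I_mul_ne (hx : 1 < x) : I * x ≠ 0 ∧ I * x - 1 ≠ 0 ∧ I * x + 1 ≠ 0 := by
  refine ⟨fun h => ?_, fun h => ?_, fun h => ?_⟩ <;>
  · have := congrArg im h
    simp at this
    linarith

theorem u_pow_five (hx : 1 < x) {ζ : ℂ} (hζ : ζ ^ 5 = 1) :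
    u ζ (x + 1 / x) ^ 5 = -(I * x + 1) ^ 2 / (I * x - 1) := by
  obtain ⟨h0, h1, h2⟩ := I_mul_ne hx
  have hb : b (x + 1 / x) = ((I * x) ^ 2 - 1) / (I * x) := eq_div_of_mul_eq h0 (b_eq hx)
  have hs : s (x + 1 / x) = ((I * x) ^ 2 + 1) / (I * x) := eq_div_of_mul_eq h0 (s_eq hx)
  have h3 : (I * x) ^ 2 - 1 ≠ 0 := by
    rw [show (I * x) ^ 2 - 1 = (I * x - 1) * (I * x + 1) by ring]; exact mul_ne_zero h1 h2
  have hexp : ∀ w : ℂ, (w ^ (1 / 5 : ℂ)) ^ 5 = w := fun w => by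
    rw [one_div]; exact cpow_ofNat_inv_pow w 5
  rw [u, Odd.neg_pow (by decide), mul_pow, mul_pow, hζ, hexp, hexp, hb, hs]
  generalize I * (x : ℂ) = y at *
  have h4 : y ^ 2 - 1 = (y - 1) * (y + 1) := by ring
  rw [h4]
  field_simp
  ring

theorem u_ne_zero (hx : 1 < x) {ζ : ℂ} (hζ : ζ ^ 5 = 1) : u ζ (x + 1 / x) ≠ 0 := by
  obtain ⟨-, h1, h2⟩ := I_mul_ne hx
  intro h
  have h5 := u_pow_five hx hζ
  rw [h, zero_pow (by norm_num), eq_comm, div_eq_zero_iff, neg_eq_zero] at h5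
  exact h5.elim (pow_ne_zero 2 h2) h1

theorem a_eq (hx : 1 < x) (ζ : ℂ) :
    a ζ (x + 1 / x) = -u ζ (x + 1 / x) ^ 2 / (I * x + 1) := by
  obtain ⟨h0, h1, h2⟩ := I_mul_ne hx
  have hb : b (x + 1 / x) = ((I * x) ^ 2 - 1) / (I * x) := eq_div_of_mul_eq h0 (b_eq hx)
  have hs : s (x + 1 / x) = ((I * x) ^ 2 + 1) / (I * x) := eq_div_of_mul_eq h0 (s_eq hx)
  rw [a, hb, hs]
  generalize u ζ (x + 1 / x) = v
  generalize I * (x : ℂ) = y at *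
  have h4 : y ^ 2 - 1 = (y - 1) * (y + 1) := by ring
  rw [h4]
  field_simp
  ring

theorem c_eq (hx : 1 < x) : c (x + 1 / x) = (I * x + 1) / (I * x) ^ 2 := by
  obtain ⟨h0, -, -⟩ := I_mul_ne hx
  have hb : b (x + 1 / x) = ((I * x) ^ 2 - 1) / (I * x) := eq_div_of_mul_eq h0 (b_eq hx)
  have hs : s (x + 1 / x) = ((I * x) ^ 2 + 1) / (I * x) := eq_div_of_mul_eq h0 (s_eq hx)
  rw [c, hb, hs]
  generalize I * (x : ℂ) = y at *
  field_simp
  ring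

theorem word_eq (hx : 1 < x) {ζ : ℂ} (hζ : ζ ^ 5 = 1) :
    A ζ (x + 1 / x) * B (x + 1 / x) * A ζ (x + 1 / x) ^ 3 * B (x + 1 / x) * A ζ (x + 1 / x) =
      C (x + 1 / x) := by
  obtain ⟨h0, h1, h2⟩ := I_mul_ne hx
  have hb : b (x + 1 / x) = ((I * x) ^ 2 - 1) / (I * x) := eq_div_of_mul_eq h0 (b_eq hx)
  have h5 := u_pow_five hx hζ
  rw [A, B, C, a_eq hx, c_eq hx, hb]
  generalize u ζ (x + 1 / x) = v at *
  generalize I * (x : ℂ) = y at *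
  -- The word is (ABA)A(ABA); after this grouping u⁵ is needed only in the diagonal entries.
  have hP : ∀ A B : Matrix (Fin 2) (Fin 2) ℂ, A * B * A ^ 3 * B * A = A * B * A * A * (A * B * A) :=
    fun A B => by noncomm_ring
  have hABA : !![v, -v ^ 2 / (y + 1); 1, 0] * !![1, 0; 0, (y ^ 2 - 1) / y] *
      !![v, -v ^ 2 / (y + 1); 1, 0] = !![v ^ 2 / y, -v ^ 3 / (y + 1); v, -v ^ 2 / (y + 1)] := by
    ext i j
    fin_cases i <;> fin_cases j <;> simp <;> field_simp
    ring
  rw [hP, hABA]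
  ext i j
  fin_cases i <;> fin_cases j <;> simp
  · have : (v ^ 2 / y * v + -v ^ 3 / (y + 1)) * (v ^ 2 / y) +
        v ^ 2 / y * (-v ^ 2 / (y + 1)) * v = v ^ 5 * (1 - y) / (y ^ 2 * (y + 1)) := by
      field_simp; ring
    rw [this, h5]; field_simp; ring
  · field_simp; ring
  · field_simp; ring
  · have : (v * v + -v ^ 2 / (y + 1)) * (-v ^ 3 / (y + 1)) +
        v * (-v ^ 2 / (y + 1)) * (-v ^ 2 / (y + 1)) = -v ^ 5 * (y - 1) / (y + 1) ^ 2 := by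
      field_simp; ring
    rw [this, h5]; field_simp

theorem exp_growthRate (hx : 1 < x) : exp (growthRate x) = b (x + 1 / x) ^ 4 := by
  have h : 0 < x + 1 / x := by positivity
  rw [← ofReal_exp, growthRate, mul_comm, Real.exp_mul, Real.exp_log h, b, mul_pow, I_pow_four,
    mul_one]
  norm_cast

theorem exp_decayRate (hx : 1 < x) :
    exp (-decayRate x + (Real.pi + Real.arctan x : ℝ) * I) = c (x + 1 / x) := by
  have hx0 : 0 < x := by linarith
  have hxc : (x : ℂ) ≠ 0 := ofReal_ne_zero.2 hx0.ne'
  have hq : 0 < 1 + x ^ 2 := by positivity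
  have hexp : Real.exp (-decayRate x) = √(1 + x ^ 2) / x ^ 2 := by
    rw [decayRate, neg_sub, Real.exp_sub, one_div, inv_mul_eq_div, ← Real.log_sqrt hq.le,
      Real.exp_log (by positivity), mul_comm, Real.exp_mul, Real.exp_log hx0]
    norm_cast
  rw [c_eq hx, ← ofReal_neg, exp_add, ← ofReal_exp, hexp, exp_mul_I, ← ofReal_cos, ← ofReal_sin,
    add_comm Real.pi, Real.cos_add_pi, Real.sin_add_pi, Real.cos_arctan, Real.sin_arctan]
  have hr : ((√(1 + x ^ 2) : ℝ) : ℂ) ≠ 0 := ofReal_ne_zero.2 (by positivity)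
  rw [mul_pow, I_sq]
  push_cast
  field_simp
  ring

theorem decayRate_pos (hx : 2 < x) : 0 < decayRate x := by
  have h : Real.log (1 + x ^ 2) < Real.log (x ^ 4) :=
    Real.log_lt_log (by positivity) (by nlinarith [sq_nonneg (x ^ 2 - 4)])
  rw [Real.log_pow] at h
  push_cast at h
  unfold decayRate
  linarith

theorem growthRate_pos (hx : 1 < x) : 0 < growthRate x := by
  have : 0 < 1 / x := by positivity
  exact mul_pos (by norm_num) (Real.log_pos (by linarith))

theorem c_ne_zero (hx : 1 < x) : c (x + 1 / x) ≠ 0 := by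
  rw [← exp_decayRate hx]; exact exp_ne_zero _

theorem norm_c_lt_one (hx : 2 < x) : ‖c (x + 1 / x)‖ < 1 := by
  rw [← exp_decayRate (by linarith), norm_exp, ← ofReal_neg, add_re, ofReal_re,
    re_ofReal_mul, I_re, mul_zero, add_zero, Real.exp_lt_one_iff, neg_lt_zero]
  exact decayRate_pos hx

theorem dense_b_pow_mul_c_pow (hx : 2 < x)
    (h : ∀ p q n : ℤ, relation p q n x = 0 → p = 0 ∧ q = 0) :
    Dense {z : ℂ | ∃ k l : ℕ, z = b (x + 1 / x) ^ k * c (x + 1 / x) ^ l} := by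
  have hx1 : 1 < x := by linarith
  refine (dense_exp_pow_mul_exp_pow (decayRate_pos hx) (growthRate_pos hx1) h).mono ?_
  rintro _ ⟨k, l, rfl⟩
  exact ⟨4 * k, l, by rw [exp_growthRate hx1, exp_decayRate hx1, pow_mul]⟩

theorem dense_gen (hx : 2 < x) (h : ∀ p q n : ℤ, relation p q n x = 0 → p = 0 ∧ q = 0) {ζ : ℂ}
    (hζ : ζ ^ 5 = 1) : Dense (gen (A ζ (x + 1 / x)) (B (x + 1 / x)) :
      Set (Matrix (Fin 2) (Fin 2) ℂ)) := by
  have hx1 : 1 < x := by linarith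
  set S := gen (A ζ (x + 1 / x)) (B (x + 1 / x)) with hS
  have hA : A ζ (x + 1 / x) ∈ S := Subsemigroup.subset_closure (by simp)
  have hB : B (x + 1 / x) ∈ S := Subsemigroup.subset_closure (by simp)
  have hC : C (x + 1 / x) ∈ S := by
    rw [← word_eq hx1 hζ, pow_three]
    exact S.mul_mem (S.mul_mem (S.mul_mem (S.mul_mem hA hB)
      (S.mul_mem hA (S.mul_mem hA hA))) hB) hA
  have ha : a ζ (x + 1 / x) ≠ 0 := by
    rw [a_eq hx1]
    exact div_ne_zero (neg_ne_zero.2 (pow_ne_zero 2 (u_ne_zero hx1 hζ))) (I_mul_ne hx1).2.2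
  intro M
  exact Subsemigroup.mem_of_dense_pow_mul_pow (S := S.topologicalClosure)
    S.isClosed_topologicalClosure (u_ne_zero hx1 hζ) ha (c_ne_zero hx1) (norm_c_lt_one hx)
    (dense_b_pow_mul_c_pow hx h) (S.le_topologicalClosure hA) (S.le_topologicalClosure hB)
    (S.le_topologicalClosure hC) M

end Parametrization

/-! ### Counting the dense semigroups. -/

theorem countable_gen (X Y : Matrix (Fin 2) (Fin 2) ℂ) :
    (gen X Y : Set (Matrix (Fin 2) (Fin 2) ℂ)).Countable := by
  refine (Set.countable_range fun l : List Bool => (l.map fun t => if t then X else Y).prod).mono ?_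
  intro M hM
  induction hM using Subsemigroup.closure_induction with
  | mem M hM =>
    rcases hM with rfl | rfl
    · exact ⟨[true], by simp⟩
    · exact ⟨[false], by simp⟩
  | mul M N _ _ hM hN =>
    obtain ⟨l, rfl⟩ := hM
    obtain ⟨l', rfl⟩ := hN
    exact ⟨l ++ l', by simp⟩

theorem b_injective : Function.Injective b := fun r r' h => by
  simpa [b, I_ne_zero] using h

theorem A_ne_B (ζ : ℂ) (r : ℝ) : A ζ r ≠ B r := fun h => by
  simpa [A, B] using congrFun (congrFun h 1) 0

/-- Different r might give the same semigroup, but r ↦ `B r` is injective, so a countable family of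
countable semigroups would account for only countably many r. -/
theorem not_countable_setOf_gen {F : Set ℝ} (hF : ¬ F.Countable)
    (hd : ∀ r ∈ F, Dense (gen (A 1 r) (B r) : Set (Matrix (Fin 2) (Fin 2) ℂ))) :
    ¬ {S : Subsemigroup (Matrix (Fin 2) (Fin 2) ℂ) |
        Dense (S : Set (Matrix (Fin 2) (Fin 2) ℂ)) ∧
        ∃ X Y : Matrix (Fin 2) (Fin 2) ℂ, X ≠ Y ∧ S = gen X Y}.Countable := by
  intro hT
  refine hF ((hT.biUnion (t := fun S _ => {r | B r ∈ S}) ?_).mono ?_)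
  · rintro S ⟨-, X, Y, -, rfl⟩
    refine (countable_gen X Y).preimage_of_injOn (f := B) (Function.Injective.injOn ?_)
    intro r r' h
    exact b_injective (by simpa [B] using congrFun (congrFun h 1) 1)
  · intro r hr
    refine Set.mem_biUnion (x := gen (A 1 r) (B r)) ⟨hd r hr, _, _, A_ne_B 1 r, rfl⟩ ?_
    exact Subsemigroup.subset_closure (by simp)

end DenseTwoGen

end

theorem mainTheorem5 :
    (∀ r : ℝ, 3 < r → ∀ ζ : ℂ, ζ ^ 5 = 1 →
      DenseTwoGen.A ζ r * DenseTwoGen.B r * DenseTwoGen.A ζ r ^ 3 * DenseTwoGen.B r *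
        DenseTwoGen.A ζ r = DenseTwoGen.C r) ∧
    (∃ F : Set ℝ, F ⊆ Set.Ioi 3 ∧ (Set.Ioi 3 \ F).Countable ∧
      ∀ r ∈ F, ∀ ζ : ℂ, ζ ^ 5 = 1 →
        Dense (DenseTwoGen.gen (DenseTwoGen.A ζ r) (DenseTwoGen.B r) :
          Set (Matrix (Fin 2) (Fin 2) ℂ))) ∧
    ¬ {S : Subsemigroup (Matrix (Fin 2) (Fin 2) ℂ) |
        Dense (S : Set (Matrix (Fin 2) (Fin 2) ℂ)) ∧
        ∃ X Y : Matrix (Fin 2) (Fin 2) ℂ, X ≠ Y ∧ S = DenseTwoGen.gen X Y}.Countable := by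
  have hF : ∃ F : Set ℝ, F ⊆ Set.Ioi 3 ∧ (Set.Ioi 3 \ F).Countable ∧
      ∀ r ∈ F, ∀ ζ : ℂ, ζ ^ 5 = 1 →
        Dense (DenseTwoGen.gen (DenseTwoGen.A ζ r) (DenseTwoGen.B r) :
          Set (Matrix (Fin 2) (Fin 2) ℂ)) := by
    refine ⟨{r | 3 < r ∧ ∀ ζ : ℂ, ζ ^ 5 = 1 →
      Dense (DenseTwoGen.gen (DenseTwoGen.A ζ r) (DenseTwoGen.B r) :
        Set (Matrix (Fin 2) (Fin 2) ℂ))}, fun r hr => hr.1,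
      (DenseTwoGen.countable_relation.image fun x => x + 1 / x).mono ?_, fun r hr => hr.2⟩
    rintro r ⟨hr, hrF⟩
    obtain ⟨x, hx, rfl⟩ := DenseTwoGen.exists_add_one_div_eq hr
    exact ⟨x, ⟨by linarith, fun h => hrF ⟨hr, fun ζ hζ => DenseTwoGen.dense_gen hx h hζ⟩⟩, rfl⟩
  refine ⟨fun r hr ζ hζ => ?_, hF, ?_⟩
  · obtain ⟨x, hx, rfl⟩ := DenseTwoGen.exists_add_one_div_eq hr
    exact DenseTwoGen.word_eq (by linarith) hζ
  · obtain ⟨F, -, hcount, hd⟩ := hF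
    refine DenseTwoGen.not_countable_setOf_gen (F := F) (fun h => ?_)
      fun r hr => hd r hr 1 (one_pow 5)
    have h3 : (Set.Ioi (3 : ℝ)).Countable :=
      (hcount.union h).mono fun r hr => by by_cases hrF : r ∈ F <;> simp_all
    exact Cardinal.aleph0_lt_continuum.not_ge
      (Cardinal.mk_Ioi_real 3 ▸ Cardinal.le_aleph0_iff_set_countable.2 h3)
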